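/- Let $G=(V,E)$ be a finite simple undirected graph. Let $\rho$ be the spectral radius (largest modulus of a complex eigenvalue) of its non-backtracking matrix $B$, which is indexed by the directed edges of $G$ (each edge $\{i,j\}\in E$ giving $i\to j$ and $j\to i$) and has entries $B_{i\to j,\,k\to \ell}=1$ if $j=k$ and $i\ne \ell$, and $0$ otherwise. (If $E=\emptyset$, put $\rho=0$.) Let $\mathrm{maxcut}(G)$ be the maximum over $S\subseteq V$ of the number of edges of $G$ with exactly one endpoint in $S$, and let $\mathrm{girth}(G)$ be the length of a shortest cycle of $G$ ($\infty$ if $G$ has no cycle). Then for every integer $m\ge 1$: if $\mathrm{girth}(G)\ge 2m+1$, then $$\mathrm{maxcut}(G)\;\ge\;|E|\left(\frac12+\frac{2\,(1-1/m)\sqrt{\rho}}{\pi(\rho+1)}\right).$$ -/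

import Mathlib

namespace SimpleGraph

/-- The non-backtracking (Hashimoto) matrix of a finite graph, indexed by its directed edges:
the entry at `(i → j, k → l)` is `1` if `j = k` and `i ≠ l`, and `0` otherwise. -/
def nonBacktrackingMatrix {V : Type*} [DecidableEq V] (G : SimpleGraph V) :
    Matrix G.Dart G.Dart ℂ :=
  fun d e => if d.snd = e.fst ∧ d.fst ≠ e.snd then 1 else 0

/-- The spectral radius of the non-backtracking matrix: the largest modulus of a complex
eigenvalue. It is a supremum over a finite set of eigenvalues, so that `toReal` loses nothing. -/
noncomputable def nonBacktrackingRadius {V : Type*} [Fintype V] [DecidableEq V]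
    (G : SimpleGraph V) [DecidableRel G.Adj] : ℝ :=
  (spectralRadius ℂ G.nonBacktrackingMatrix).toReal

/-- The maximum cut: the largest number of edges between a set `S` of vertices and its
complement. Each cut edge is counted once, as the pair (endpoint in `S`, endpoint outside). -/
def maxCut {V : Type*} [Fintype V] [DecidableEq V]
    (G : SimpleGraph V) [DecidableRel G.Adj] : ℕ :=
  (Finset.univ : Finset (Finset V)).sup fun S => (G.interedges S Sᶜ).card

end SimpleGraph

/-! ### Gaussian measure of planar sectors -/

section

open MeasureTheory ProbabilityTheory Real Filter Topology
open scoped ENNReal NNReal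

/-! Goemans–Williamson rounding: if unit vectors on the vertices have inner product at most -κ along
every edge, a random Gaussian hyperplane cuts each edge with probability at least 1/2 + κ/π
(`le_maxCut_of_inner_le`).

To find the vectors, fix l > ρ. The Neumann series for (l - B)⁻¹1 gives weights a ≥ 0 on darts with
l·a(v,w) + a(w,v) = N(w), where N(w) = 1 + Σₓ a(w,x) (`exists_edge_weights`). Let X_v be a sum of m
orthogonal shells of squared norm N(v)/l; shell k spreads along non-backtracking walks from v with
sign (-1)^j at distance j, and pendant paths account for the 1 in N. Girth at least 2m+1 makes balls
tree-like, so pieces leaving v through different darts have disjoint supports. Across an edge only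
consecutive shells interact, whence ⟨X_v, X_w⟩ ≤ -(m-1)(a(v,w) + a(w,v))/√l (`exists_wave_vectors`).

Adding the weight equations of both orientations gives N(v) + N(w) = (l+1)(a(v,w) + a(w,v)), so
AM-GM bounds ‖X_v‖‖X_w‖ and κ = (1 - 1/m)·2√l/(l+1) works after normalising. Finally l tends to ρ
from above. -/

lemma gaussianPDF_mul_gaussianPDF_polar (r θ : ℝ) :
    gaussianPDF 0 1 (r * cos θ) * gaussianPDF 0 1 (r * sin θ) =
      gaussianPDF 0 1 r * gaussianPDF 0 1 0 := by
  simp only [gaussianPDF, ← ENNReal.ofReal_mul (gaussianPDFReal_nonneg _ _ _)]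
  congr 1
  simp only [gaussianPDFReal]
  rw [mul_mul_mul_comm, mul_mul_mul_comm (_)⁻¹ (rexp _), ← Real.exp_add, ← Real.exp_add]
  congr 2
  simp only [sub_zero, mul_pow, NNReal.coe_one]
  linear_combination (-(r ^ 2) / 2) * Real.sin_sq_add_cos_sq θ

lemma gaussian_prod_eq_withDensity :
    (gaussianReal 0 1).prod (gaussianReal 0 1) =
      (volume : Measure (ℝ × ℝ)).withDensity
        (fun p => gaussianPDF 0 1 p.1 * gaussianPDF 0 1 p.2) := by
  rw [gaussianReal_of_var_ne_zero 0 one_ne_zero, Measure.volume_eq_prod]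
  exact prod_withDensity (by fun_prop) (by fun_prop)

/-- The standard Gaussian mass of an open angular sector of the plane. -/
lemma gaussian_prod_sector {s : Set (ℝ × ℝ)} (hs : MeasurableSet s) {a b : ℝ} (ha : -π ≤ a)
    (hb : b ≤ π) (hsub : ∀ r θ : ℝ, 0 < r → a < θ → θ < b → (r * cos θ, r * sin θ) ∈ s) :
    ENNReal.ofReal ((b - a) / (2 * π)) ≤ (gaussianReal 0 1).prod (gaussianReal 0 1) s := by
  set F : ℝ → ℝ≥0∞ := fun r => ENNReal.ofReal r * (gaussianPDF 0 1 r * gaussianPDF 0 1 0) with hF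
  have hFm : Measurable F := by fun_prop
  have key (c d : ℝ) : ∫⁻ p in Set.Ioi (0 : ℝ) ×ˢ Set.Ioo c d, F p.1 =
      (∫⁻ r in Set.Ioi (0 : ℝ), F r) * ENNReal.ofReal (d - c) := by
    rw [Measure.volume_eq_prod, ← Measure.prod_restrict,
      lintegral_prod _ (by fun_prop)]
    simp only [lintegral_const, Measure.restrict_apply_univ, Real.volume_Ioo]
    rw [lintegral_mul_const _ hFm]
  have hpol (t : Set (ℝ × ℝ)) (ht : MeasurableSet t) :
      (gaussianReal 0 1).prod (gaussianReal 0 1) t = ∫⁻ p in polarCoord.target,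
        ENNReal.ofReal p.1 • t.indicator
          (fun p => gaussianPDF 0 1 p.1 * gaussianPDF 0 1 p.2) (polarCoord.symm p) := by
    rw [lintegral_comp_polarCoord_symm, gaussian_prod_eq_withDensity, withDensity_apply _ ht,
      lintegral_indicator ht]
  -- Total mass 1 fixes the radial integral, so it never has to be evaluated.
  have hK : (∫⁻ r in Set.Ioi (0 : ℝ), F r) * ENNReal.ofReal (2 * π) = 1 := by
    have h := hpol Set.univ MeasurableSet.univ
    rw [measure_univ] at h
    rw [h, show 2 * π = π - -π by ring, ← key, polarCoord_target]
    refine lintegral_congr fun p => ?_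
    simp [hF, polarCoord_symm_apply, gaussianPDF_mul_gaussianPDF_polar]
  have hle : (∫⁻ r in Set.Ioi (0 : ℝ), F r) * ENNReal.ofReal (b - a) ≤
      (gaussianReal 0 1).prod (gaussianReal 0 1) s := by
    rw [hpol s hs, ← key]
    have hsubset : Set.Ioi (0 : ℝ) ×ˢ Set.Ioo a b ⊆ polarCoord.target := by
      rw [polarCoord_target]
      exact Set.prod_mono le_rfl (Set.Ioo_subset_Ioo ha hb)
    refine le_trans (le_of_eq ?_) (lintegral_mono_set hsubset)
    refine setLIntegral_congr_fun (measurableSet_Ioi.prod measurableSet_Ioo) ?_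
    rintro ⟨r, θ⟩ ⟨hr, hθ⟩
    have := hsub r θ hr hθ.1 hθ.2
    simp [hF, polarCoord_symm_apply, Set.indicator_of_mem this, gaussianPDF_mul_gaussianPDF_polar]
  refine le_trans (le_of_eq ?_) hle
  have h2 : ENNReal.ofReal (2 * π) ≠ 0 := by simp [Real.pi_pos]
  rw [ENNReal.ofReal_div_of_pos (by positivity), ENNReal.div_eq_inv_mul,
    ENNReal.eq_inv_of_mul_eq_one_left hK]

/-! ### Hyperplane rounding -/

section Rounding

variable {E : Type*} [NormedAddCommGroup E] [InnerProductSpace ℝ E] [FiniteDimensional ℝ E]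
  [MeasurableSpace E] [BorelSpace E]

lemma map_inner_stdGaussian (x : E) :
    (stdGaussian E).map (fun g => inner ℝ x g) = gaussianReal 0 (‖x‖₊ ^ 2) := by
  have h := (IsGaussian.map_eq_gaussianReal (μ := stdGaussian E) (innerSL ℝ x))
  simp only [variance_dual_stdGaussian, integral_strongDual_stdGaussian] at h
  have e : (fun g => inner ℝ x g) = (innerSL ℝ x : E → ℝ) := rfl
  rw [e, h]
  congr
  ext
  simp

lemma map_inner_prod_stdGaussian {x w : E} (h : inner ℝ x w = 0) :
    (stdGaussian E).map (fun g => (inner ℝ x g, inner ℝ w g)) =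
      (gaussianReal 0 (‖x‖₊ ^ 2)).prod (gaussianReal 0 (‖w‖₊ ^ 2)) := by
  have hi : IndepFun (fun g : E => inner ℝ x g) (fun g => inner ℝ w g) (stdGaussian E) := by
    refine HasGaussianLaw.indepFun_of_covariance_eq_zero ?_ ?_
    · exact (IsGaussian.hasGaussianLaw_id (μ := stdGaussian E)).map_fun
        ((innerSL ℝ x).prod (innerSL ℝ w))
    · rw [← covarianceBilin_apply_eq_cov IsGaussian.memLp_two_id, covarianceBilin_stdGaussian]
      exact h
  rw [(indepFun_iff_map_prod_eq_prod_map_map (by fun_prop) (by fun_prop)).1 hi,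
    map_inner_stdGaussian, map_inner_stdGaussian]

lemma quadrant_le_stdGaussian {x y : E} (hx : ‖x‖ = 1) (hy : ‖y‖ = 1) {κ : ℝ} (hκ : 0 ≤ κ)
    (hxy : inner ℝ x y ≤ -κ) :
    ENNReal.ofReal (1 / 4 + κ / (2 * π)) ≤
      stdGaussian E {g | 0 < inner ℝ x g ∧ ¬ 0 < inner ℝ y g} := by
  set c : ℝ := -inner ℝ x y with hc
  have hcκ : κ ≤ c := by linarith
  have hc1 : c ≤ 1 := by
    have := abs_real_inner_le_norm x y
    rw [hx, hy, one_mul] at this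
    exact (neg_le_abs _).trans this
  set β := arcsin c with hβ
  have hsin : sin β = c := sin_arcsin (by linarith) hc1
  have hβ0 : 0 ≤ β := arcsin_nonneg.2 (hκ.trans hcκ)
  have hβ2 : β ≤ π / 2 := arcsin_le_pi_div_two c
  have hcβ : c ≤ β := hsin ▸ sin_le hβ0
  set w : E := y + c • x with hw
  have hxw : inner ℝ x w = 0 := by
    rw [hw, inner_add_right, inner_smul_right, real_inner_self_eq_norm_sq, hx]
    simp [hc]
  have hwn : ‖w‖ ^ 2 = cos β ^ 2 := by
    rw [hw, norm_add_sq_real, inner_smul_right, real_inner_comm, norm_smul, hx, hy, cos_sq',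
      hsin, Real.norm_eq_abs, mul_one, sq_abs]
    have : inner ℝ x y = -c := by simp [hc]
    rw [this]; ring
  have hpre : {g : E | 0 < inner ℝ x g ∧ ¬ 0 < inner ℝ y g} =
      (fun g => ((inner ℝ x g : ℝ), (inner ℝ w g : ℝ))) ⁻¹' {p | 0 < p.1 ∧ p.2 ≤ c * p.1} := by
    ext g
    simp only [Set.mem_ofPred_eq, Set.mem_preimage, hw, inner_add_left, inner_smul_left, not_lt,
      conj_trivial, add_le_iff_nonpos_left]
  have hm : MeasurableSet {p : ℝ × ℝ | 0 < p.1 ∧ p.2 ≤ c * p.1} :=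
    (measurableSet_lt measurable_const measurable_fst).inter
      (measurableSet_le measurable_snd (by fun_prop))
  -- Scaling a standard Gaussian by cos β, instead of normalising `w`, also covers y = -x, where `w`
  -- vanishes.
  have hscale : (gaussianReal 0 (‖x‖₊ ^ 2)).prod (gaussianReal 0 (‖w‖₊ ^ 2)) =
      ((gaussianReal 0 1).prod (gaussianReal 0 1)).map (Prod.map id (cos β * ·)) := by
    rw [← Measure.map_prod_map _ _ measurable_id (by fun_prop), Measure.map_id,
      gaussianReal_map_const_mul]
    congr 2
    · ext; simp [hx]
    · simp
    · ext; simp [hwn]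
  rw [hpre, ← Measure.map_apply (by fun_prop) hm, map_inner_prod_stdGaussian hxw, hscale,
    Measure.map_apply (by fun_prop) hm]
  -- In the rescaled plane the event contains the sector -π/2 < θ < β, and β = arcsin c ≥ c ≥ κ.
  refine le_trans (ENNReal.ofReal_le_ofReal ?_)
    (gaussian_prod_sector (a := -(π / 2)) (b := β) (hm.preimage (by fun_prop))
      (by linarith [pi_pos]) (by linarith [pi_pos]) ?_)
  · have h : (β - -(π / 2)) / (2 * π) = 1 / 4 + β / (2 * π) := by field_simp; ring
    rw [h]
    gcongr
    exact hcκ.trans hcβ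
  · intro r θ hr h1 h2
    simp only [Set.mem_preimage, Prod.map_apply, id, Set.mem_ofPred_eq]
    refine ⟨mul_pos hr (cos_pos_of_mem_Ioo ⟨by linarith, by linarith⟩), ?_⟩
    have h3 : sin (θ - β) ≤ 0 := sin_nonpos_of_nonpos_of_neg_pi_le (by linarith) (by linarith)
    rw [sin_sub] at h3
    rw [← hsin]
    nlinarith

end Rounding

namespace SimpleGraph
variable {V : Type*}

lemma card_filter_adj [Fintype V] [DecidableEq V] (G : SimpleGraph V) [DecidableRel G.Adj] :
    (Finset.univ.filter fun p : V × V => G.Adj p.1 p.2).card = 2 * G.edgeFinset.card := by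
  rw [← G.dart_card_eq_twice_card_edges, ← Finset.card_univ]
  symm
  refine Finset.card_bij (fun d _ => d.toProd) (fun d _ => by simp)
    (fun d _ e _ h => Dart.ext _ _ h) fun p hp => ⟨⟨p, by simpa using hp⟩, by simp, rfl⟩

/-- Hyperplane rounding: a system of unit vectors with negative correlation along every edge yields
a large cut. -/
theorem le_maxCut_of_inner_le [Fintype V] [DecidableEq V] (G : SimpleGraph V) [DecidableRel G.Adj]
    {E : Type*} [NormedAddCommGroup E] [InnerProductSpace ℝ E] [FiniteDimensional ℝ E]
    (x : V → E) (hx : ∀ v, ‖x v‖ = 1) {κ : ℝ} (hκ : 0 ≤ κ)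
    (hadj : ∀ v w, G.Adj v w → inner ℝ (x v) (x w) ≤ -κ) :
    (G.edgeFinset.card : ℝ) * (1 / 2 + κ / π) ≤ G.maxCut := by
  let _ : MeasurableSpace E := borel E
  have : BorelSpace E := ⟨rfl⟩
  -- Ordered pairs: each edge occurs in both orientations, which doubles 1/4 + κ/(2π).
  set P := Finset.univ.filter fun p : V × V => G.Adj p.1 p.2 with hP
  let A : V × V → Set E := fun p => {g | 0 < inner ℝ (x p.1) g ∧ ¬ 0 < inner ℝ (x p.2) g}
  have hA (p) : MeasurableSet (A p) :=
    (measurableSet_lt (f := fun _ => (0 : ℝ)) (g := fun g => inner ℝ (x p.1) g)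
      measurable_const (by fun_prop)).inter
      (measurableSet_lt (f := fun _ => (0 : ℝ)) (g := fun g => inner ℝ (x p.2) g)
        measurable_const (by fun_prop)).compl
  have hcut (g : E) : ∑ p ∈ P, (A p).indicator (fun _ => (1 : ENNReal)) g ≤ G.maxCut := by
    classical
    set S := Finset.univ.filter fun v => 0 < inner ℝ (x v) g with hS
    have h1 : (G.interedges S Sᶜ).card ≤ G.maxCut :=
      Finset.le_sup (f := fun S => (G.interedges S Sᶜ).card) (Finset.mem_univ S)
    have h2 : ∑ p ∈ P, (A p).indicator (fun _ => (1 : ENNReal)) g =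
        (G.interedges S Sᶜ).card := by
      simp only [Set.indicator_apply]
      rw [Finset.sum_boole]
      congr 2
      ext p
      simp only [Finset.mem_filter, Finset.mem_univ, true_and, mem_interedges_iff,
        Finset.mem_compl, hP, A, hS, Set.mem_ofPred_eq]
      tauto
    rw [h2]
    exact_mod_cast h1
  have hsum : ∑ p ∈ P, stdGaussian E (A p) ≤ G.maxCut := by
    calc ∑ p ∈ P, stdGaussian E (A p)
        = ∫⁻ g, ∑ p ∈ P, (A p).indicator (fun _ => (1 : ENNReal)) g ∂stdGaussian E := by
          rw [lintegral_finsetSum _ fun p _ => measurable_const.indicator (hA p)]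
          simp [lintegral_indicator (hA _)]
      _ ≤ ∫⁻ _, (G.maxCut : ENNReal) ∂stdGaussian E := lintegral_mono hcut
      _ = G.maxCut := by simp
  have hlow : ∑ p ∈ P, ENNReal.ofReal (1 / 4 + κ / (2 * π)) ≤ G.maxCut :=
    le_trans (Finset.sum_le_sum fun p hp => quadrant_le_stdGaussian (hx _) (hx _) hκ
      (hadj _ _ (by simpa [hP] using hp))) hsum
  rw [Finset.sum_const, nsmul_eq_mul, hP, card_filter_adj,
    ← ENNReal.ofReal_natCast, ← ENNReal.ofReal_natCast (maxCut G),
    ← ENNReal.ofReal_mul (by positivity), ENNReal.ofReal_le_ofReal_iff (by positivity)] at hlow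
  refine le_trans (le_of_eq ?_) hlow
  push_cast
  field_simp
  ring

end SimpleGraph

/-! ### Distances below the girth -/

namespace SimpleGraph
variable {V : Type*} {G : SimpleGraph V}

/-- The union of the two paths is not acyclic, since a forest has at most one path between two
vertices; a cycle in it uses each edge at most once. -/
lemma egirth_le_length_add_length {a b : V} {p q : G.Walk a b} (hp : p.IsPath) (hq : q.IsPath)
    (hne : p ≠ q) : G.egirth ≤ (p.length + q.length : ℕ) := by
  classical
  set H : SimpleGraph V := fromEdgeSet {e | e ∈ p.edges ∨ e ∈ q.edges} with hH
  have hmem {e} : e ∈ H.edgeSet → e ∈ p.edges ∨ e ∈ q.edges := by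
    rw [hH, edgeSet_fromEdgeSet]; exact fun h => h.1
  have hsub : ∀ e, e ∈ p.edges ∨ e ∈ q.edges → e ∈ G.edgeSet := fun e he =>
    he.elim (p.edges_subset_edgeSet ·) (q.edges_subset_edgeSet ·)
  have hmem' {e} (he : e ∈ p.edges ∨ e ∈ q.edges) : e ∈ H.edgeSet := by
    rw [hH, edgeSet_fromEdgeSet]
    exact ⟨he, G.not_isDiag_of_mem_edgeSet (hsub e he)⟩
  have hHG : H ≤ G := by
    rw [← edgeSet_subset_edgeSet]
    exact fun e he => hsub e (hmem he)
  have hnot : ¬ H.IsAcyclic := by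
    intro hac
    have h := (hac.subsingleton_path a b).elim
      ⟨p.transfer H fun e he => hmem' (Or.inl he), hp.transfer _⟩
      ⟨q.transfer H fun e he => hmem' (Or.inr he), hq.transfer _⟩
    have h2 := congrArg Walk.support (congrArg Subtype.val h)
    simp only [Walk.support_transfer] at h2
    exact hne (Walk.ext_support h2)
  simp only [IsAcyclic, not_forall, not_not] at hnot
  obtain ⟨v, c, hc⟩ := hnot
  have hlen : c.length ≤ p.length + q.length := by
    rw [← Walk.length_edges, ← Walk.length_edges p, ← Walk.length_edges q, ← List.length_append]
    refine (List.subperm_of_subset hc.edges_nodup fun e he => ?_).length_le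
    rw [List.mem_append]
    exact hmem (c.edges_subset_edgeSet he)
  have h3 := Walk.IsCycle.mapLe hHG hc
  calc G.egirth ≤ ((c.mapLe hHG).length : ℕ∞) := h3.egirth_le_length
    _ = (c.length : ℕ∞) := by simp
    _ ≤ _ := by exact_mod_cast hlen

lemma Walk.isPath_of_length_eq_edist {a b : V} (p : G.Walk a b)
    (hp : (p.length : ℕ∞) = G.edist a b) : p.IsPath := by
  refine p.isPath_of_length_eq_dist ?_
  rw [SimpleGraph.dist, ← hp, ENat.toNat_natCast]

/-- Below the girth, the first step of a shortest path is unique. -/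
lemma eq_of_edist_eq_of_lt_egirth {v w w' u : V} {j : ℕ} (hw : G.Adj v w) (hw' : G.Adj v w')
    (h : G.edist w u = j) (h' : G.edist w' u = j) (hv : G.edist v u = (j + 1 : ℕ))
    (hg : ((2 * j + 2 : ℕ) : ℕ∞) < G.egirth) : w = w' := by
  by_contra hne
  obtain ⟨p, hp⟩ := exists_walk_of_edist_eq_coe h
  obtain ⟨q, hq⟩ := exists_walk_of_edist_eq_coe h'
  have h1 : (Walk.cons hw p).IsPath :=
    Walk.isPath_of_length_eq_edist _ (by rw [hv, Walk.length_cons, hp])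
  have h2 : (Walk.cons hw' q).IsPath :=
    Walk.isPath_of_length_eq_edist _ (by rw [hv, Walk.length_cons, hq])
  have h3 := egirth_le_length_add_length h1 h2 (by
    intro he
    have := congrArg (fun r => r.getVert 1) he
    simp at this
    exact hne this)
  refine absurd hg (not_lt.2 (h3.trans ?_))
  simp only [Walk.length_cons, hp, hq]
  exact_mod_cast (by omega)

/-- Below the girth, a non-backtracking step away from a vertex increases the distance. -/
lemma edist_eq_add_two_of_lt_egirth {v w x u : V} {j : ℕ} (hvw : G.Adj v w) (hwx : G.Adj w x)
    (hne : v ≠ x) (hx : G.edist x u = j) (hw : G.edist w u = (j + 1 : ℕ))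
    (hg : ((2 * j + 3 : ℕ) : ℕ∞) < G.egirth) : G.edist v u = (j + 2 : ℕ) := by
  have h1 : G.edist v u ≤ (j + 2 : ℕ) := by
    refine (SimpleGraph.edist_triangle (v := w)).trans ?_
    rw [edist_eq_one_iff_adj.2 hvw, hw]
    exact_mod_cast (by omega)
  have h2 : (j + 1 : ℕ) ≤ 1 + G.edist v u := by
    rw [← hw, ← edist_eq_one_iff_adj.2 hvw.symm]
    exact SimpleGraph.edist_triangle
  obtain ⟨n, hn⟩ := ENat.ne_top_iff_exists.1 (ne_top_of_le_ne_top (ENat.natCast_ne_top _) h1)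
  rw [← hn] at h1 h2 ⊢
  norm_cast at h1 h2 ⊢
  have h3 : n ≠ j := by
    rintro rfl
    exact hne (eq_of_edist_eq_of_lt_egirth hvw.symm hwx hn.symm hx hw
      (lt_of_le_of_lt (by exact_mod_cast (by omega)) hg))
  -- Otherwise paths of lengths j + 2 (through `w`) and j + 1 join `v` to `u`, forcing a cycle of
  -- length at most 2j + 3.
  have h4 : n ≠ j + 1 := by
    rintro rfl
    obtain ⟨p, hp⟩ := exists_walk_of_edist_eq_coe hw
    obtain ⟨q, hq⟩ := exists_walk_of_edist_eq_coe hn.symm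
    have hpp := Walk.isPath_of_length_eq_edist p (by rw [hw, hp])
    have hqp := Walk.isPath_of_length_eq_edist q (by rw [← hn, hq])
    classical
    have hvp : v ∉ p.support := by
      intro hmem
      have hle := edist_le (p.dropUntil v hmem)
      rw [← hn] at hle
      norm_cast at hle
      have hl := congrArg Walk.length (p.take_spec hmem)
      rw [Walk.length_append, hp] at hl
      exact hvw.ne (Walk.eq_of_length_eq_zero (p := p.takeUntil v hmem) (by omega)).symm
    have hcp : (Walk.cons hvw p).IsPath := by
      rw [Walk.cons_isPath_iff]; exact ⟨hpp, hvp⟩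
    have h3 := egirth_le_length_add_length hcp hqp (by
      intro he
      have := congrArg Walk.length he
      simp [hp, hq] at this)
    refine absurd hg (not_lt.2 (h3.trans ?_))
    simp only [Walk.length_cons, hp, hq]
    exact_mod_cast (by omega)
  omega

end SimpleGraph

/-! ### Neumann series and edge weights -/

section Resolvent
attribute [local instance] Matrix.linftyOpNormedRing Matrix.linftyOpNormedAlgebra

lemma spectralRadius_matrix_lt_top {ι : Type*} [Fintype ι] [DecidableEq ι] [Nonempty ι]
    (B : Matrix ι ι ℂ) : spectralRadius ℂ B < ⊤ :=
  lt_of_le_of_lt (spectrum.spectralRadius_le_pow_nnnorm_pow_one_div ℂ B 0) (by simp)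

/-- Gelfand's formula, with r strictly between the spectral radius and l. -/
lemma exists_eventually_norm_pow_le {A : Type*} [NormedRing A] [NormedAlgebra ℂ A]
    [CompleteSpace A] (B : A) {l : ℝ} (hB : spectralRadius ℂ B < ENNReal.ofReal l) :
    ∃ r : ℝ, 0 < r ∧ r < l ∧ ∀ᶠ k : ℕ in atTop, ‖B ^ k‖ ≤ r ^ k := by
  obtain ⟨r, hr1, hr2⟩ := ENNReal.lt_iff_exists_nnreal_btwn.1 hB
  have hr0 : 0 < r := by exact_mod_cast (zero_le.trans_lt hr1)
  have hrl : (r : ℝ) < l := by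
    rw [← ENNReal.ofReal_coe_nnreal] at hr2
    exact (ENNReal.ofReal_lt_ofReal_iff_of_nonneg r.2).1 hr2
  refine ⟨r, hr0, hrl, ?_⟩
  have h := spectrum.pow_nnnorm_pow_one_div_tendsto_nhds_spectralRadius B
  filter_upwards [h.eventually_lt_const hr1, eventually_gt_atTop 0] with k hk hk0
  have h1 : (‖B ^ k‖₊ : ℝ≥0∞) < (r : ℝ≥0∞) ^ (k : ℝ) := by
    rwa [one_div, ENNReal.rpow_inv_lt_iff (by exact_mod_cast hk0)] at hk
  rw [ENNReal.rpow_natCast] at h1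
  exact_mod_cast h1.le

/-- Above its spectral radius, a nonnegative matrix has a nonnegative resolvent. -/
lemma exists_nonneg_mul_eq_one_add_mulVec {ι : Type*} [Fintype ι] [DecidableEq ι]
    (M : Matrix ι ι ℝ) (hM : ∀ i j, 0 ≤ M i j) {l : ℝ} (hl : 0 < l)
    (hB : spectralRadius ℂ (M.map Complex.ofReal) < ENNReal.ofReal l) :
    ∃ φ : ι → ℝ, (∀ i, 0 ≤ φ i) ∧ ∀ i, l * φ i = 1 + (M.mulVec φ) i := by
  set c : ℕ → ι → ℝ := fun k => (M ^ k).mulVec 1 with hc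
  have hpow (k : ℕ) : ∀ i j, 0 ≤ (M ^ k) i j := by
    induction k with
    | zero => intro i j; rw [pow_zero, Matrix.one_apply]; split <;> norm_num
    | succ k ih =>
      intro i j
      rw [pow_succ, Matrix.mul_apply]
      exact Finset.sum_nonneg fun x _ => mul_nonneg (ih _ _) (hM _ _)
  have hc0 (k i) : 0 ≤ c k i := by
    simp only [hc, Matrix.mulVec, dotProduct, Pi.one_apply, mul_one]
    exact Finset.sum_nonneg fun x _ => hpow _ _ _
  have hcs (k i) : c (k + 1) i = M.mulVec (c k) i := by
    simp only [hc, Matrix.mulVec_mulVec, pow_succ']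
  have hle (k i) : c k i ≤ ‖(M.map Complex.ofReal) ^ k‖ := by
    have h1 : ((M.map Complex.ofReal) ^ k).mulVec 1 i = ((c k i : ℝ) : ℂ) := by
      have : (M.map Complex.ofReal) ^ k = (M ^ k).map Complex.ofReal :=
        (map_pow (Complex.ofRealHom.mapMatrix) M k).symm
      simp [this, hc, Matrix.mulVec, dotProduct]
    have h2 : ‖((c k i : ℝ) : ℂ)‖ = c k i := by simp [abs_of_nonneg (hc0 k i)]
    rw [← h2, ← h1]
    refine (norm_le_pi_norm _ i).trans ((Matrix.linfty_opNorm_mulVec _ _).trans ?_)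
    have h3 : ‖(1 : ι → ℂ)‖ ≤ 1 := (pi_norm_le_iff_of_nonneg zero_le_one).2 (by simp)
    exact mul_le_of_le_one_right (norm_nonneg _) h3
  obtain ⟨r, hr0, hrl, hev⟩ := exists_eventually_norm_pow_le _ hB
  have hsum (i) : Summable fun k : ℕ => l⁻¹ ^ (k + 1) * c k i := by
    have hgeo : Summable fun k : ℕ => l⁻¹ * (r / l) ^ k :=
      (summable_geometric_of_lt_one (by positivity) ((div_lt_one hl).2 hrl)).mul_left _
    refine Summable.of_norm_bounded_eventually_nat hgeo ?_
    filter_upwards [hev] with k hk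
    rw [Real.norm_of_nonneg (mul_nonneg (by positivity) (hc0 k i)), div_eq_mul_inv, mul_pow,
      pow_succ]
    have := (hle k i).trans hk
    have hp : 0 ≤ l⁻¹ ^ k * l⁻¹ := by positivity
    nlinarith [mul_le_mul_of_nonneg_left this hp]
  refine ⟨fun i => ∑' k, l⁻¹ ^ (k + 1) * c k i, fun i => tsum_nonneg fun k =>
    mul_nonneg (by positivity) (hc0 k i), fun i => ?_⟩
  beta_reduce
  rw [(hsum i).tsum_eq_zero_add, mul_add]
  congr 1
  · simp [hc, hl.ne']
  · simp only [Matrix.mulVec, dotProduct]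
    simp_rw [← tsum_mul_left]
    rw [← Summable.tsum_finsetSum fun j _ => (hsum j).mul_left _]
    refine tsum_congr fun k => ?_
    rw [hcs, Matrix.mulVec, dotProduct, Finset.mul_sum, Finset.mul_sum]
    refine Finset.sum_congr rfl fun j _ => ?_
    have h : l * l⁻¹ = 1 := mul_inv_cancel₀ hl.ne'
    linear_combination (l⁻¹ ^ (k + 1) * M i j * c k j) * h

end Resolvent

namespace SimpleGraph
variable {V : Type*} [Fintype V] [DecidableEq V] (G : SimpleGraph V) [DecidableRel G.Adj]

lemma exists_nonBacktracking_resolvent [Nonempty G.Dart] {l : ℝ}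
    (hl : G.nonBacktrackingRadius < l) :
    ∃ φ : G.Dart → ℝ, (∀ d, 0 ≤ φ d) ∧
      ∀ d, l * φ d = 1 + ∑ e, if d.snd = e.fst ∧ d.fst ≠ e.snd then φ e else 0 := by
  have hl0 : 0 < l := lt_of_le_of_lt ENNReal.toReal_nonneg hl
  set M : Matrix G.Dart G.Dart ℝ := fun d e => if d.snd = e.fst ∧ d.fst ≠ e.snd then 1 else 0
    with hM
  have hmap : M.map Complex.ofReal = G.nonBacktrackingMatrix := by
    ext d e
    rw [Matrix.map_apply]
    simp only [hM, nonBacktrackingMatrix]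
    split_ifs <;> simp
  obtain ⟨φ, h0, h1⟩ := exists_nonneg_mul_eq_one_add_mulVec M
    (fun d e => by simp only [hM]; split <;> norm_num) hl0 (by
      rw [hmap]
      exact (ENNReal.lt_ofReal_iff_toReal_lt (spectralRadius_matrix_lt_top _).ne).2 hl)
  refine ⟨φ, h0, fun d => ?_⟩
  rw [h1]
  simp [hM, Matrix.mulVec, dotProduct]

/-- The resolvent of the non-backtracking matrix, as a function of pairs of vertices. -/
lemma exists_edge_weights [Nonempty G.Dart] {l : ℝ} (hl : G.nonBacktrackingRadius < l) :
    ∃ a : V → V → ℝ, (∀ v w, 0 ≤ a v w) ∧ (∀ v w, ¬ G.Adj v w → a v w = 0) ∧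
      ∀ v w, G.Adj v w → l * a v w + a w v = 1 + ∑ x, a w x := by
  obtain ⟨φ, h0, h1⟩ := G.exists_nonBacktracking_resolvent hl
  refine ⟨fun v w => if h : G.Adj v w then φ ⟨(v, w), h⟩ else 0, fun v w => ?_,
    fun v w h => dif_neg h, fun v w h => ?_⟩
  · dsimp only
    split
    · exact h0 _
    · exact le_rfl
  · have key : ∑ e : G.Dart, (if w = e.fst ∧ v ≠ e.snd then φ e else 0) =
        ∑ x ∈ Finset.univ.erase v, if h : G.Adj w x then φ ⟨(w, x), h⟩ else 0 := by
      rw [← Finset.sum_filter, ← Finset.sum_filter_of_ne (p := fun x => G.Adj w x)]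
      · refine Finset.sum_bij' (fun e _ => e.snd)
          (fun x hx => ⟨(w, x), (Finset.mem_filter.1 hx).2⟩) ?_ ?_ ?_ ?_ ?_
        · rintro e he
          simp only [Finset.mem_filter, Finset.mem_univ, true_and] at he
          obtain ⟨rfl, h2⟩ := he
          simp [Ne.symm h2]
        · intro x hx
          simp only [Finset.mem_filter, Finset.mem_erase, Finset.mem_univ, and_true] at hx
          simp [Ne.symm hx.1]
        · rintro e he
          simp only [Finset.mem_filter, Finset.mem_univ, true_and] at he
          obtain ⟨rfl, h2⟩ := he
          rfl
        · intro x hx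
          rfl
        · rintro e he
          simp only [Finset.mem_filter, Finset.mem_univ, true_and] at he
          obtain ⟨rfl, h2⟩ := he
          simp
      · intro x _ hx
        by_contra hn
        simp [hn] at hx
    beta_reduce
    rw [← Finset.add_sum_erase _ _ (Finset.mem_univ v), ← key, dif_pos h, h1]
    ring

end SimpleGraph

/-! ### Wave vectors and their inner products -/

namespace SimpleGraph
/-- A basis vector of the auxiliary space attached to the vertex `w` and the level `j`; for positive
`j` it stands for the `j`-th vertex of a pendant path attached at `w`. -/
noncomputable def levelVec {V : Type*} [DecidableEq V] (m j : ℕ) (w : V) (c : ℝ) : EuclideanSpace ℝ (V × Fin (m + 1)) :=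
  EuclideanSpace.single (w, Fin.ofNat (m + 1) j) c

lemma levelVec_apply_ne_zero {V : Type*} [DecidableEq V] {m j : ℕ} (hj : j ≤ m) {w u : V}
    {i : Fin (m + 1)} {c : ℝ}
    (h : levelVec m j w c (u, i) ≠ 0) : u = w ∧ (i : ℕ) = j := by
  rw [levelVec, PiLp.single_apply] at h
  have h2 := (ite_ne_right_iff.1 h).1
  rw [Prod.mk.injEq] at h2
  refine ⟨h2.1, ?_⟩
  rw [h2.2, Fin.val_ofNat, Nat.mod_eq_of_lt (by omega)]

variable {V : Type*} [Fintype V] [DecidableEq V] (G : SimpleGraph V) [DecidableRel G.Adj]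
  (m : ℕ) (l : ℝ) (a : V → V → ℝ)

/-- The contribution of the non-backtracking walks of length `k + 1` that start with `v → w`. -/
noncomputable def waveDart : ℕ → V → V → EuclideanSpace ℝ (V × Fin (m + 1))
  | 0, v, w => if G.Adj v w then levelVec m 0 w (-√(a v w / l)) else 0
  | k + 1, v, w => if G.Adj v w then
      -(√l)⁻¹ • (∑ x ∈ Finset.univ.erase v, waveDart k w x + levelVec m (k + 1) w (√(1 / l)))
    else 0

/-- The contribution of the non-backtracking walks of length `k` that start at `v`. -/
noncomputable def waveShell : ℕ → V → EuclideanSpace ℝ (V × Fin (m + 1))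
  | 0, v => levelVec m 0 v (√((1 + ∑ x, a v x) / l))
  | k + 1, v => ∑ x, G.waveDart m l a k v x + levelVec m (k + 1) v (√(1 / l))

variable {G m l a}

lemma inner_eq_zero_of_disjoint {ι : Type*} [Fintype ι] {f g : EuclideanSpace ℝ ι}
    (h : ∀ i, f i ≠ 0 → g i ≠ 0 → False) : inner ℝ f g = 0 := by
  rw [PiLp.inner_apply]
  refine Finset.sum_eq_zero fun i _ => ?_
  by_cases hf : f i = 0
  · simp [hf]
  · simp [not_not.1 fun hg => h i hf hg]

lemma inner_levelVec_self (j : ℕ) (w : V) {c : ℝ} (hc : 0 ≤ c) :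
    inner ℝ (levelVec m j w (√c)) (levelVec m j w (√c)) = c := by
  rw [real_inner_self_eq_norm_sq, levelVec, PiLp.norm_single, norm_eq_abs, sq_abs,
    sq_sqrt hc]

/-- Distance from `w` plus level on the pendant path is always `k`: below the girth, each step
prepended by the recursion increases the distance by one. Every orthogonality relation below is read
off from this support. -/
lemma waveDart_apply_ne_zero (hg : ((2 * m + 1 : ℕ) : ℕ∞) ≤ G.egirth) {k : ℕ} (hk : k + 1 ≤ m)
    {v w u : V} {i : Fin (m + 1)} (h : G.waveDart m l a k v w (u, i) ≠ 0) :
    G.Adj v w ∧ ∃ j : ℕ, G.edist w u = j ∧ G.edist v u = (j + 1 : ℕ) ∧ j + i = k := by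
  induction k generalizing v w with
  | zero =>
    rw [waveDart] at h
    split_ifs at h with hvw
    · obtain ⟨rfl, hi⟩ := levelVec_apply_ne_zero (by omega) h
      exact ⟨hvw, 0, by simp, by simpa using edist_eq_one_iff_adj.2 hvw, by omega⟩
    · simp at h
  | succ k ih =>
    rw [waveDart] at h
    split_ifs at h with hvw
    · refine ⟨hvw, ?_⟩
      rw [PiLp.smul_apply, smul_eq_mul, PiLp.add_apply] at h
      have h' := right_ne_zero_of_mul h
      by_cases hl0 : levelVec m (k + 1) w (√(1 / l)) (u, i) = 0
      · rw [hl0, add_zero, WithLp.ofLp_sum, Finset.sum_apply] at h'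
        obtain ⟨x, hx, hx0⟩ := Finset.exists_ne_zero_of_sum_ne_zero h'
        obtain ⟨hwx, j, h1, h2, h3⟩ := ih (by omega) hx0
        refine ⟨j + 1, h2, edist_eq_add_two_of_lt_egirth hvw hwx
          (Finset.ne_of_mem_erase hx).symm h1 h2 (lt_of_lt_of_le ?_ hg), by omega⟩
        exact_mod_cast (by omega)
      · obtain ⟨rfl, hi⟩ := levelVec_apply_ne_zero (by omega) hl0
        exact ⟨0, by simp, by simpa using edist_eq_one_iff_adj.2 hvw, by omega⟩
    · simp at h

lemma waveShell_apply_ne_zero (hg : ((2 * m + 1 : ℕ) : ℕ∞) ≤ G.egirth) {k : ℕ} (hk : k ≤ m)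
    {v u : V} {i : Fin (m + 1)} (h : G.waveShell m l a k v (u, i) ≠ 0) :
    ∃ j : ℕ, G.edist v u = j ∧ j + i = k := by
  cases k with
  | zero =>
    obtain ⟨rfl, hi⟩ := levelVec_apply_ne_zero (by omega) h
    exact ⟨0, by simp, by omega⟩
  | succ k =>
    rw [waveShell, PiLp.add_apply] at h
    by_cases hl0 : levelVec m (k + 1) v (√(1 / l)) (u, i) = 0
    · rw [hl0, add_zero, WithLp.ofLp_sum, Finset.sum_apply] at h
      obtain ⟨x, hx, hx0⟩ := Finset.exists_ne_zero_of_sum_ne_zero h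
      obtain ⟨-, j, h1, h2, h3⟩ := waveDart_apply_ne_zero hg hk hx0
      exact ⟨j + 1, h2, by omega⟩
    · obtain ⟨rfl, hi⟩ := levelVec_apply_ne_zero (by omega) hl0
      exact ⟨0, by simp, by omega⟩

/-- At a common coordinate, distance plus level determines `k`, and uniqueness of the first step of
a shortest path determines `w`. -/
lemma inner_waveDart_of_ne (hg : ((2 * m + 1 : ℕ) : ℕ∞) ≤ G.egirth) {k k' : ℕ} (hk : k + 1 ≤ m)
    (hk' : k' + 1 ≤ m) {v w w' : V} (hne : k ≠ k' ∨ w ≠ w') :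
    inner ℝ (G.waveDart m l a k v w) (G.waveDart m l a k' v w') = 0 := by
  refine inner_eq_zero_of_disjoint ?_
  rintro ⟨u, i⟩ h h'
  obtain ⟨hw, j, h1, h2, h3⟩ := waveDart_apply_ne_zero hg hk h
  obtain ⟨hw', j', h1', h2', h3'⟩ := waveDart_apply_ne_zero hg hk' h'
  have hj : j + 1 = j' + 1 := by exact_mod_cast h2.symm.trans h2'
  obtain rfl : j = j' := by omega
  have : w = w' := eq_of_edist_eq_of_lt_egirth hw hw' h1 h1' h2
    (lt_of_lt_of_le (by exact_mod_cast (by omega)) hg)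
  rcases hne with hne | hne
  · omega
  · exact hne this

/-- A common vertex would be farther from `v` than from `w`, and conversely. -/
lemma inner_waveDart_swap (hg : ((2 * m + 1 : ℕ) : ℕ∞) ≤ G.egirth) {k k' : ℕ} (hk : k + 1 ≤ m)
    (hk' : k' + 1 ≤ m) {v w : V} :
    inner ℝ (G.waveDart m l a k v w) (G.waveDart m l a k' w v) = 0 := by
  refine inner_eq_zero_of_disjoint ?_
  rintro ⟨u, i⟩ h h'
  obtain ⟨-, j, h1, h2, h3⟩ := waveDart_apply_ne_zero hg hk h
  obtain ⟨-, j', h1', h2', h3'⟩ := waveDart_apply_ne_zero hg hk' h'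
  have e1 : j = j' + 1 := by exact_mod_cast h1.symm.trans h2'
  have e2 : j + 1 = j' := by exact_mod_cast h2.symm.trans h1'
  omega

lemma inner_waveDart_levelVec (hg : ((2 * m + 1 : ℕ) : ℕ∞) ≤ G.egirth) {k j : ℕ} (hk : k + 1 ≤ m)
    (hj : j ≤ m) {v w : V} {c : ℝ} :
    inner ℝ (G.waveDart m l a k v w) (levelVec m j v c) = 0 := by
  refine inner_eq_zero_of_disjoint ?_
  rintro ⟨u, i⟩ h h'
  obtain ⟨-, j, h1, h2, h3⟩ := waveDart_apply_ne_zero hg hk h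
  obtain ⟨rfl, -⟩ := levelVec_apply_ne_zero hj h'
  rw [edist_self] at h2
  norm_cast at h2

lemma inner_sum_waveDart_add_levelVec (hg : ((2 * m + 1 : ℕ) : ℕ∞) ≤ G.egirth) (hl : 0 < l) {k : ℕ}
    (hk : k + 1 ≤ m) {v : V} {s : Finset V}
    (h : ∀ w ∈ s, inner ℝ (G.waveDart m l a k v w) (G.waveDart m l a k v w) = a v w / l) :
    inner ℝ (∑ x ∈ s, G.waveDart m l a k v x + levelVec m (k + 1) v (√(1 / l)))
      (∑ x ∈ s, G.waveDart m l a k v x + levelVec m (k + 1) v (√(1 / l))) =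
      (1 + ∑ x ∈ s, a v x) / l := by
  have h1 : inner ℝ (∑ x ∈ s, G.waveDart m l a k v x) (levelVec m (k + 1) v (√(1 / l))) = 0 := by
    rw [sum_inner]
    exact Finset.sum_eq_zero fun x _ => inner_waveDart_levelVec hg hk hk
  have h2 : inner ℝ (∑ x ∈ s, G.waveDart m l a k v x) (∑ x ∈ s, G.waveDart m l a k v x) =
      ∑ x ∈ s, a v x / l := by
    rw [sum_inner]
    refine Finset.sum_congr rfl fun x hx => ?_
    rw [inner_sum, Finset.sum_eq_single_of_mem x hx, h x hx]
    exact fun y _ hy => inner_waveDart_of_ne hg hk hk (Or.inr hy.symm)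
  rw [inner_add_left, inner_add_right, inner_add_right, real_inner_comm _ (levelVec _ _ _ _), h1, h2,
    inner_levelVec_self _ _ (by positivity), ← Finset.sum_div]
  ring


/-- The norm does not depend on `k`: removing the backtracking term a(w,v) from N(w) leaves exactly
l·a(v,w). The pendant vector of squared norm 1/l supplies the 1 in N(w). -/
lemma inner_waveDart_self (ha : ∀ v w, 0 ≤ a v w) (ha0 : ∀ v w, ¬ G.Adj v w → a v w = 0)
    (hal : ∀ v w, G.Adj v w → l * a v w + a w v = 1 + ∑ x, a w x)
    (hg : ((2 * m + 1 : ℕ) : ℕ∞) ≤ G.egirth) (hl : 0 < l) {k : ℕ} (hk : k + 1 ≤ m) (v w : V) :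
    inner ℝ (G.waveDart m l a k v w) (G.waveDart m l a k v w) = a v w / l := by
  induction k generalizing v w with
  | zero =>
    rw [waveDart]
    split_ifs with hvw
    · have := ha v w
      rw [real_inner_self_eq_norm_sq, levelVec, PiLp.norm_single, norm_neg, norm_eq_abs,
        sq_abs, sq_sqrt (by positivity)]
    · simp [ha0 v w hvw]
  | succ k ih =>
    rw [waveDart]
    split_ifs with hvw
    · rw [inner_smul_left, inner_smul_right,
        inner_sum_waveDart_add_levelVec hg hl (by omega) fun x _ => ih (by omega) w x]
      have h1 := hal v w hvw
      rw [← Finset.add_sum_erase _ _ (Finset.mem_univ v)] at h1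
      have h2 : 1 + ∑ x ∈ Finset.univ.erase v, a w x = l * a v w := by linarith
      rw [h2]
      simp only [conj_trivial]
      field_simp
      rw [sq_sqrt hl.le]
    · simp [ha0 v w hvw]

lemma inner_waveShell_self (ha : ∀ v w, 0 ≤ a v w) (ha0 : ∀ v w, ¬ G.Adj v w → a v w = 0)
    (hal : ∀ v w, G.Adj v w → l * a v w + a w v = 1 + ∑ x, a w x)
    (hg : ((2 * m + 1 : ℕ) : ℕ∞) ≤ G.egirth) (hl : 0 < l) {k : ℕ} (hk : k ≤ m) (v : V) :
    inner ℝ (G.waveShell m l a k v) (G.waveShell m l a k v) = (1 + ∑ x, a v x) / l := by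
  cases k with
  | zero =>
    have := Finset.sum_nonneg fun x (_ : x ∈ Finset.univ) => ha v x
    exact inner_levelVec_self _ _ (by positivity)
  | succ k =>
    exact inner_sum_waveDart_add_levelVec hg hl hk fun x _ =>
      inner_waveDart_self ha ha0 hal hg hl hk v x

lemma inner_waveShell_of_ne (hg : ((2 * m + 1 : ℕ) : ℕ∞) ≤ G.egirth) {k k' : ℕ} (hk : k ≤ m)
    (hk' : k' ≤ m) (hne : k ≠ k') (v : V) :
    inner ℝ (G.waveShell m l a k v) (G.waveShell m l a k' v) = 0 := by
  refine inner_eq_zero_of_disjoint ?_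
  rintro ⟨u, i⟩ h h'
  obtain ⟨j, h1, h2⟩ := waveShell_apply_ne_zero hg hk h
  obtain ⟨j', h1', h2'⟩ := waveShell_apply_ne_zero hg hk' h'
  have : j = j' := by exact_mod_cast h1.symm.trans h1'
  omega

/-- Splits the shell at the edge: the part through `w`, and the rest, which is what a walk entering
`v` from `w` continues with. Shells at both ends are thus written in the same two families of dart
vectors. -/
lemma waveShell_succ_eq (hl : 0 < l) (k : ℕ) {v w : V} (h : G.Adj v w) :
    G.waveShell m l a (k + 1) v =
      G.waveDart m l a k v w - √l • G.waveDart m l a (k + 1) w v := by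
  have hs : √l ≠ 0 := (sqrt_pos.2 hl).ne'
  rw [waveShell, waveDart, if_pos h.symm, neg_smul, smul_neg, smul_inv_smul₀ hs, sub_neg_eq_add,
    ← Finset.add_sum_erase _ _ (Finset.mem_univ w), add_assoc]

/-- Only an inequality, because shell 0 is concentrated at `v` with coefficient √(N(v)/l), which is
at least √a(w,v). -/
lemma inner_waveShell_zero_succ_le (ha : ∀ v w, 0 ≤ a v w)
    (hal : ∀ v w, G.Adj v w → l * a v w + a w v = 1 + ∑ x, a w x)
    (hg : ((2 * m + 1 : ℕ) : ℕ∞) ≤ G.egirth) (hl : 0 < l) {k : ℕ} (hk : k + 1 < m) {v w : V}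
    (h : G.Adj v w) :
    inner ℝ (G.waveShell m l a 0 v) (G.waveShell m l a (k + 1) w) ≤
      -((√l)⁻¹ * if k = 0 then a w v else 0) := by
  rw [waveShell_succ_eq hl k h.symm, inner_sub_right, inner_smul_right, waveShell,
    real_inner_comm _ (levelVec _ _ _ _), real_inner_comm _ (levelVec _ _ _ _),
    inner_waveDart_levelVec hg (by omega) (by omega), mul_zero, sub_zero]
  cases k with
  | zero =>
    rw [waveDart, if_pos h.symm, levelVec, levelVec, EuclideanSpace.inner_single_left,
      if_pos rfl, PiLp.single_apply, if_pos rfl]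
    have h1 := hal w v h.symm
    have h2 := ha w v
    have h3 := ha v w
    have h4 : a w v ≤ (1 + ∑ x, a v x) / l := by
      rw [le_div_iff₀ hl]; linarith
    have h5 : √(a w v / l) * √(a w v) ≤ √(a w v / l) * √((1 + ∑ x, a v x) / l) :=
      mul_le_mul_of_nonneg_left (sqrt_le_sqrt h4) (sqrt_nonneg _)
    rw [sqrt_div h2, div_mul_eq_mul_div, mul_self_sqrt h2, ← sqrt_div h2] at h5
    simp only [conj_trivial, neg_mul]
    rw [neg_le_neg_iff, ← div_eq_inv_mul]
    exact h5
  | succ k =>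
    rw [if_neg (by omega), mul_zero, neg_zero]
    refine (inner_eq_zero_of_disjoint ?_).le
    rintro ⟨u, i⟩ h1 h2
    obtain ⟨-, j, h3, -, h4⟩ := waveDart_apply_ne_zero hg (by omega) h1
    obtain ⟨rfl, h5⟩ := levelVec_apply_ne_zero (by omega) h2
    rw [edist_self] at h3
    have : 0 = j := by exact_mod_cast h3
    omega

lemma inner_waveShell_adj_le (ha : ∀ v w, 0 ≤ a v w) (ha0 : ∀ v w, ¬ G.Adj v w → a v w = 0)
    (hal : ∀ v w, G.Adj v w → l * a v w + a w v = 1 + ∑ x, a w x)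
    (hg : ((2 * m + 1 : ℕ) : ℕ∞) ≤ G.egirth) (hl : 0 < l) {k k' : ℕ} (hk : k < m) (hk' : k' < m)
    {v w : V} (h : G.Adj v w) :
    inner ℝ (G.waveShell m l a k v) (G.waveShell m l a k' w) ≤
      -((√l)⁻¹ * ((if k = k' + 1 then a v w else 0) + if k' = k + 1 then a w v else 0)) := by
  rcases k with _ | k <;> rcases k' with _ | k'
  · simp only [Nat.zero_add, zero_ne_one, if_false, add_zero, mul_zero, neg_zero]
    refine (inner_eq_zero_of_disjoint ?_).le
    rintro ⟨u, i⟩ h1 h2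
    obtain ⟨rfl, -⟩ := levelVec_apply_ne_zero (by omega) h1
    obtain ⟨h3, -⟩ := levelVec_apply_ne_zero (by omega) h2
    exact h.ne h3
  · simpa using inner_waveShell_zero_succ_le ha hal hg hl hk' h
  · rw [real_inner_comm]
    simpa using inner_waveShell_zero_succ_le ha hal hg hl hk h.symm
  · have hself (n : ℕ) (hn : n + 1 ≤ m) (x y : V) :=
      inner_waveDart_self ha ha0 hal hg hl hn x y
    have e1 : inner ℝ (G.waveDart m l a k v w) (G.waveDart m l a (k' + 1) v w) =
        if k = k' + 1 then a v w / l else 0 := by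
      split_ifs with he
      · subst he; exact hself _ (by omega) _ _
      · exact inner_waveDart_of_ne hg (by omega) (by omega) (Or.inl he)
    have e2 : inner ℝ (G.waveDart m l a (k + 1) w v) (G.waveDart m l a k' w v) =
        if k' = k + 1 then a w v / l else 0 := by
      split_ifs with he
      · subst he; exact hself _ (by omega) _ _
      · exact inner_waveDart_of_ne hg (by omega) (by omega) (Or.inl (Ne.symm he))
    rw [waveShell_succ_eq hl k h, waveShell_succ_eq hl k' h.symm, inner_sub_left, inner_sub_right,
      inner_sub_right, inner_smul_left, inner_smul_left, inner_smul_right, inner_smul_right, e1, e2,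
      inner_waveDart_swap hg (by omega) (by omega), inner_waveDart_swap hg (by omega) (by omega)]
    refine le_of_eq ?_
    have hs : √l / l = (√l)⁻¹ := sqrt_div_self'.trans (one_div _)
    simp only [conj_trivial, Nat.add_right_cancel_iff, ← hs]
    split_ifs <;> ring

end SimpleGraph

/-! ### Assembling the cut bound -/

namespace SimpleGraph
variable {V : Type*} [Fintype V] [DecidableEq V] {G : SimpleGraph V} [DecidableRel G.Adj]

/-- Among n + 1 shells there are n consecutive pairs: the source of the factor 1 - 1/m. -/
lemma sum_range_sum_range_ite_eq_succ (n : ℕ) (c : ℝ) :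
    ∑ k ∈ Finset.range (n + 1), ∑ k' ∈ Finset.range (n + 1), (if k = k' + 1 then c else 0) =
      n * c := by
  rw [Finset.sum_comm]
  have h (k' : ℕ) : ∑ k ∈ Finset.range (n + 1), (if k = k' + 1 then c else 0) =
      if k' < n then c else 0 := by
    rw [Finset.sum_ite_eq']
    simp
  simp_rw [h]
  rw [Finset.sum_range_succ, if_neg (lt_irrefl n), add_zero,
    Finset.sum_congr rfl fun k hk => if_pos (Finset.mem_range.1 hk)]
  simp

/-- The unnormalised wave vectors: squared norms and correlations along edges. -/
lemma exists_wave_vectors {n : ℕ} {l : ℝ} {a : V → V → ℝ} (ha : ∀ v w, 0 ≤ a v w)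
    (ha0 : ∀ v w, ¬ G.Adj v w → a v w = 0)
    (hal : ∀ v w, G.Adj v w → l * a v w + a w v = 1 + ∑ x, a w x)
    (hg : ((2 * (n + 1) + 1 : ℕ) : ℕ∞) ≤ G.egirth) (hl : 0 < l) :
    ∃ X : V → EuclideanSpace ℝ (V × Fin (n + 1 + 1)),
      (∀ v, ‖X v‖ ^ 2 = (n + 1) * ((1 + ∑ x, a v x) / l)) ∧
      ∀ v w, G.Adj v w → inner ℝ (X v) (X w) ≤ -((√l)⁻¹ * (n * (a v w + a w v))) := by
  refine ⟨fun v => ∑ k ∈ Finset.range (n + 1), G.waveShell (n + 1) l a k v, fun v => ?_,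
    fun v w h => ?_⟩
  · rw [← real_inner_self_eq_norm_sq, sum_inner,
      Finset.sum_congr rfl (g := fun _ => (1 + ∑ x, a v x) / l)]
    · simp
    · intro k hk
      have hk1 := Finset.mem_range.1 hk
      rw [inner_sum, Finset.sum_eq_single_of_mem k hk,
        inner_waveShell_self ha ha0 hal hg hl hk1.le]
      exact fun j hj hne => inner_waveShell_of_ne hg hk1.le (Finset.mem_range.1 hj).le hne.symm v
  · rw [sum_inner]
    simp_rw [inner_sum]
    refine (Finset.sum_le_sum fun k hk => Finset.sum_le_sum fun k' hk' =>
      inner_waveShell_adj_le ha ha0 hal hg hl (Finset.mem_range.1 hk) (Finset.mem_range.1 hk')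
        h).trans (le_of_eq ?_)
    simp_rw [Finset.sum_neg_distrib, ← Finset.mul_sum, Finset.sum_add_distrib]
    rw [sum_range_sum_range_ite_eq_succ, Finset.sum_comm, sum_range_sum_range_ite_eq_succ]
    ring

lemma le_maxCut_of_nonBacktrackingRadius_lt [Nonempty G.Dart] {n : ℕ}
    (hg : ((2 * (n + 1) + 1 : ℕ) : ℕ∞) ≤ G.egirth) {l : ℝ} (hl : G.nonBacktrackingRadius < l) :
    (G.edgeFinset.card : ℝ) * (1 / 2 + (n / (n + 1) * (2 * √l / (l + 1))) / π) ≤ G.maxCut := by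
  have hl0 : 0 < l := lt_of_le_of_lt ENNReal.toReal_nonneg hl
  obtain ⟨a, ha, ha0, hal⟩ := G.exists_edge_weights hl
  obtain ⟨X, hX, hXadj⟩ := exists_wave_vectors ha ha0 hal hg hl0
  have hN (v) : 0 < 1 + ∑ x, a v x := by
    have := Finset.sum_nonneg fun x (_ : x ∈ Finset.univ) => ha v x
    linarith
  have hpos (v) : 0 < ‖X v‖ := by
    have : 0 < ‖X v‖ ^ 2 := by rw [hX]; have := hN v; positivity
    exact (norm_nonneg _).lt_of_ne' fun h0 => by simp [h0] at this
  refine le_maxCut_of_inner_le G (fun v => ‖X v‖⁻¹ • X v) (fun v => ?_) (by positivity)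
    fun v w h => ?_
  · rw [norm_smul, norm_inv, norm_norm, inv_mul_cancel₀ (hpos v).ne']
  · rw [inner_smul_left, inner_smul_right, conj_trivial]
    have hs0 := sqrt_pos.2 hl0
    have hsum : ‖X v‖ ^ 2 + ‖X w‖ ^ 2 = (n + 1) * ((l + 1) * (a v w + a w v) / l) := by
      rw [hX, hX, ← hal v w h, ← hal w v h.symm]
      ring
    have hprod : ‖X v‖ * ‖X w‖ ≤ (n + 1) * ((l + 1) * (a v w + a w v) / l) / 2 := by
      nlinarith [sq_nonneg (‖X v‖ - ‖X w‖)]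
    have hκ : n / (n + 1) * (2 * √l / (l + 1)) * (‖X v‖ * ‖X w‖) ≤
        (√l)⁻¹ * (n * (a v w + a w v)) := by
      refine (mul_le_mul_of_nonneg_left hprod (by positivity)).trans (le_of_eq ?_)
      have hs : √l / l = (√l)⁻¹ := sqrt_div_self'.trans (one_div _)
      rw [← hs]
      field_simp
    rw [← mul_assoc, ← mul_inv, inv_mul_le_iff₀ (mul_pos (hpos v) (hpos w))]
    linarith [hXadj v w h]

end SimpleGraph

end

theorem corollary4 {V : Type*} [Fintype V] [DecidableEq V] (G : SimpleGraph V)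
    [DecidableRel G.Adj] (m : ℕ) (hm : 1 ≤ m)
    (hgirth : ((2 * m + 1 : ℕ) : ℕ∞) ≤ G.egirth) :
    (G.edgeFinset.card : ℝ) *
        (1 / 2 + 2 * (1 - 1 / (m : ℝ)) * Real.sqrt G.nonBacktrackingRadius /
          (Real.pi * (G.nonBacktrackingRadius + 1))) ≤
      (G.maxCut : ℝ) := by
  obtain ⟨n, rfl⟩ : ∃ n, m = n + 1 := ⟨m - 1, by omega⟩
  rcases isEmpty_or_nonempty G.Dart with hE | hE
  · have h := G.dart_card_eq_twice_card_edges
    rw [Fintype.card_eq_zero] at h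
    have h0 : G.edgeFinset.card = 0 := by omega
    rw [h0]
    simp
  · set ρ := G.nonBacktrackingRadius with hρ
    have hρ0 : 0 ≤ ρ := ENNReal.toReal_nonneg
    -- The weights were built only for l > ρ, so the bound at ρ itself comes by continuity.
    have hcont : ContinuousAt (fun l : ℝ => (G.edgeFinset.card : ℝ) *
        (1 / 2 + (n / (n + 1) * (2 * Real.sqrt l / (l + 1))) / Real.pi)) ρ := by
      have : ρ + 1 ≠ 0 := by positivity
      fun_prop (disch := assumption)
    have hlim := le_of_tendsto (hcont.tendsto.mono_left nhdsWithin_le_nhds)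
      (Filter.eventually_of_mem (self_mem_nhdsWithin (s := Set.Ioi ρ)) fun l hl =>
        SimpleGraph.le_maxCut_of_nonBacktrackingRadius_lt hgirth hl)
    refine le_trans (le_of_eq ?_) hlim
    push_cast
    field_simp
    ring
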